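/- **Terms and reduction.** Fix two sets $\mathcal K_+,\mathcal K_-$ of positive and negative instructions, where $\mathcal K_+$ contains a constant $\maltese_+$ and a constant $\overline n$ for each $n\in\mathbb N$, all distinct, and $\mathcal K_-$ contains a constant $\maltese_-$. With positive variables $x$, negative variables $\alpha$ and variables $\kappa$ of either polarity, put $$V::=V_+\mid t_-,\quad V_+::=x\mid (V,V')\mid\{V\}\mid k_+,\quad t_+::=V_+\mid\mu\alpha.c,\quad t_-::=\alpha\mid\mu(\kappa,\kappa').c\mid\mu\{\kappa\}.c\mid\mu x.c\mid k_-,\quad c::=\langle t_+|t_-\rangle ,$$ modulo $\alpha$-equivalence, with $\langle t|u\rangle=\langle u|t\rangle$. On closed commands let $\langle\mu\alpha.c|t_-\rangle\to_\mu c[t_- /\alpha]$, $\langle V_+|\mu x.c\rangle\to_\mu c[V_+/x]$, $\langle\{V\}|\mu\{\kappa\}.c\rangle\to_\beta c[V/\kappa]$ and $\langle(V,V')|\mu(\kappa,\kappa').c\rangle\to_\beta c[V/\kappa,V'/\kappa']$ (the last two only if the polarities of variables and values match), and $\to_0=\to_\mu\cup\to_\beta$. **Countdown machine.** A forcing command $c\{K\}$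 consists of a closed command $c=\langle t|u\rangle$ and a closed term $K$; it is denoted by both of the expressions $\langle t^\ominus|(u,K)\rangle$ and $\langle u^\ominus|(t,K)\rangle$, where $t,u$ have opposite polarities. For each $n\in\mathbb N$: if $c\to_\mu c'$ then $c\{\overline n\}\to_\bullet c'\{\overline n\}$; if $c\to_\beta c'$ then $c\{\overline{n+1}\}\to_\bullet c'\{\overline n\}$, while $c\{\overline 0\}$ diverges. A forcing command normalizes if it reduces by $\to_\bullet^*$ to one that neither reduces nor diverges. **Constructors.** Kinds are $\sigma,\tau::=\iota\mid o^+\mid o^-\mid\sigma\to\tau$, with $(o^\pm)^\perp=o^\mp$, $\iota^\perp=\iota$, $(\sigma\to\tau)^\perp=\sigma\to\tau^\perp$. Constructors are the simply kinded expressions built from variables $x^\tau$ and their negations, $\lambda$, application, $\mathbf 0:\iota$, $\mathbf s:\iota\to\iota$, recursors $rec_\tau$ and their negations, $A\otimes B:o^+$, $A\parr B:o^-$, $\downarrow A:o^+$, $\uparrow A:o^-$ ($A,B$ formulas of any polarity), and $\exists x^\tau.A$, $\forall x^\tau.A$, $\langle T=U\rangle A$ (of the polarity of $A$); negation $(\cdot)^\perp$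 is extended by De Morgan duality, with $\langle T=U\rangle A$ commuting with it. For the forcing side add a constant $\mathcal C[\cdot]:\iota\to o^+$ and its negation. Write $A\multimap B=A^\perp\parr B$. **Realizability.** Let $\mathcal M$ be a commutative monoid, and let an orthogonality relation be given between weighted closed terms $(u,q)$ with $u$ positive, and weighted closed terms $(t,p)$ on the "negative side"; $X^\perp$ denotes the orthogonal of a set from one side to the other. Let $X\otimes Y=\{((V,W),p+q):(V,p)\in X,(W,q)\in Y\}$ and $\downarrow X=\{(\{V\},p):(V,p)\in X\}$ ($V,W$ values). A positive propositional domain $\mathcal D^\oplus$ is a set of sets of weighted closed positive values, closed under arbitrary unions and non-empty intersections, and containing $X\otimes Y$ and $\downarrow X$ for all $X,Y\in\mathcal D^\oplus\cup\mathcal D^\ominus$, where $\mathcal D^\ominus=\{X^\perp:X\in\mathcal D^\oplus\}$. Kinds are interpreted by $|\iota|=\mathbb N$, $|o^+|=\mathcal D^\oplus$, $|o^-|=\mathcal D^\ominus$ (each element being given with an $X\in\mathcal D^\oplus$ of which it is the orthogonal), $|\sigma\to\tau|=|\tau|^{|\sigma|}$. Under a total valuation $\rho$ constructors are interpreted in the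 standard way, $|A^\perp|$ being the pointwise orthogonal of $|A|$ (with $(X^\perp)^\perp:=X$ for $X\in\mathcal D^\oplus$), and $$|A\otimes B|=|A|\otimes|B|,\quad |\downarrow A|=\downarrow|A|,\quad |A\parr B|=(|A^\perp|\otimes|B^\perp|)^\perp,\quad |\uparrow A|=(\downarrow|A^\perp|)^\perp;$$ for positive $P$, $|\exists x.P|$ and $|\forall x.P|$ are the union and the intersection over the values of $x$; for negative $N$, $|\forall x.N|=|\exists x.N^\perp|^\perp$ and $|\exists x.N|=|\forall x.N^\perp|^\perp$; and $|\langle T=U\rangle A|$ is $|A|$ if $|T|=|U|$, and otherwise $\emptyset$ if $A$ is positive and $\emptyset^\perp$ if $A$ is negative. A weighted term realizes a formula $A$ if it belongs to $|A|^{\perp\perp}$. **Formulas and forcing.** MAL formulas are given by $A,B::=P\mid N$, $P::=X\mid A\otimes B\mid\downarrow A$, $N::=X^\perp\mid A\parr B\mid\uparrow A$; they are constructors, $X$ being a variable of kind $o^+$. To each $X$ is also associated a variable $X^{\iota\to o^+}$. With $p+q$ the addition on $\iota$ defined by $rec_\iota$, and $\overline Z:=\lambda r.\forall r'.\,Z(r')\multimap\mathcal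 C[r+r']^\perp$, put $$X^*=X^{\iota\to o^+},\qquad (A\otimes B)^*=\lambda r.\exists p_1.\exists p_2.\langle r=p_1+p_2\rangle(A^*(p_1)\otimes B^*(p_2)),\qquad (\downarrow A)^*=\lambda r.\downarrow A^*(r),$$ $(X^\perp)^*=\overline{X^*}$, $(A\parr B)^*=\overline{(A^\perp\otimes B^\perp)^*}$, $(\uparrow A)^*=\overline{(\downarrow A^\perp)^*}$. Define $p\Vdash_f P:=\overline{\overline{P^*}}(p)$ for positive $P$ and $p\Vdash_f N:=N^*(p)$ for negative $N$. Let $\mathbf n=\mathbf s^n\mathbf 0$. **The two models.** *(Time)* $\mathcal M=(\mathbb N,+)$; the negative side consists of the weighted negative terms; $(u_+,q)\perp(t_-,p)$ iff $\langle u_+|t_-\rangle$ normalizes for $\to_0$ using at most $q+p$ $\beta$-steps; $\mathcal D^\oplus$ is any positive propositional domain and $\rho$ any total valuation with $\rho(X)=\{(\maltese_+,p):p\in\mathbb N\}$ for every MAL variable $X$. Realizability in this model is written $(t,n)\Vdash_{\mathbf{Time}}A$. *(Countdown reducibility candidates)* $\mathcal M=\{0\}$ (weights are omitted); the negative side consists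 of all closed terms, of either polarity; $u_+\perp t$ iff $\langle t^\ominus|u_+\rangle$ denotes a forcing command (that is, $u_+=(V,K)$ is a pair with $V$ of polarity opposite to that of $t$) and this forcing command normalizes; $\mathcal D_\bullet^\oplus$ is any positive propositional domain that contains the sets $\{\overline n:p\le n\}$ for $p\in\mathbb N$; $\mathcal C[\cdot]$ is interpreted by $p\mapsto\{\overline n:p\le n\}$; $\rho_\bullet$ is any total valuation with $\rho_\bullet(X^{\iota\to o^+})(p)=\{\maltese_+\}$ for every MAL variable $X$ and $p\in\mathbb N$. Realizability in this model is written $t\Vdash_\bullet A$. **Theorem.** For every MAL formula $A$, every closed term $t$ and every $n\in\mathbb N$, $$(t,n)\Vdash_{\mathbf{Time}}A\iff t\Vdash_\bullet(\mathbf n\Vdash_f A).$$ -/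

import Mathlib

/-! ## Polarities, terms, commands -/

/-- The two polarities. -/
inductive Pol : Type
  | pos
  | neg
  deriving DecidableEq

/-- The opposite polarity. -/
@[reducible] def Pol.dual : Pol → Pol
  | .pos => .neg
  | .neg => .pos

/-- The syntactic categories of the term calculus: positive values, positive terms, negative
terms (which are all values) and commands. -/
inductive Cat : Type
  | pval
  | ptm
  | ntm
  | cmd

/-- The category of the values of a given polarity. -/
@[reducible] def Pol.valCat : Pol → Cat
  | .pos => .pval
  | .neg => .ntm

/-- Term variables of polarity `p` in a scope `Γ` (de Bruijn indices). -/
inductive TVar : List Pol → Pol → Type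
  | zero {Γ : List Pol} {p : Pol} : TVar (p :: Γ) p
  | succ {Γ : List Pol} {p q : Pol} : TVar Γ p → TVar (q :: Γ) p

/-- The syntax of the focalising calculus, modulo α-equivalence, in the scope `Γ`. The
positive instructions are `daiP`, the primitive integers `num n`, and the elements of `Kp`; the
negative instructions are `daiN` and the elements of `Km`. A command is stored
with its positive term first, which realises the identification of `⟨t|u⟩` and `⟨u|t⟩`. -/
inductive Syn (Kp Km : Type) : List Pol → Cat → Type
  | pvar {Γ : List Pol} (x : TVar Γ .pos) : Syn Kp Km Γ .pval
  | pair {Γ : List Pol} {p q : Pol} (V : Syn Kp Km Γ p.valCat) (W : Syn Kp Km Γ q.valCat) :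
      Syn Kp Km Γ .pval
  | box {Γ : List Pol} {p : Pol} (V : Syn Kp Km Γ p.valCat) : Syn Kp Km Γ .pval
  | daiP {Γ : List Pol} : Syn Kp Km Γ .pval
  | num {Γ : List Pol} (n : ℕ) : Syn Kp Km Γ .pval
  | instrP {Γ : List Pol} (k : Kp) : Syn Kp Km Γ .pval
  /-- a positive value is a positive term -/
  | ofVal {Γ : List Pol} (V : Syn Kp Km Γ .pval) : Syn Kp Km Γ .ptm
  /-- `μ α . c` -/
  | muNeg {Γ : List Pol} (c : Syn Kp Km (.neg :: Γ) .cmd) : Syn Kp Km Γ .ptm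
  | nvar {Γ : List Pol} (x : TVar Γ .neg) : Syn Kp Km Γ .ntm
  /-- `μ (κ, κ') . c`, where `κ` is the variable of index zero and `κ'` that of index one -/
  | muPair {Γ : List Pol} {p q : Pol} (c : Syn Kp Km (p :: q :: Γ) .cmd) : Syn Kp Km Γ .ntm
  /-- `μ {κ} . c` -/
  | muBox {Γ : List Pol} {p : Pol} (c : Syn Kp Km (p :: Γ) .cmd) : Syn Kp Km Γ .ntm
  /-- `μ x . c` -/
  | muPos {Γ : List Pol} (c : Syn Kp Km (.pos :: Γ) .cmd) : Syn Kp Km Γ .ntm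
  | daiN {Γ : List Pol} : Syn Kp Km Γ .ntm
  | instrN {Γ : List Pol} (k : Km) : Syn Kp Km Γ .ntm
  /-- `⟨t|u⟩` -/
  | cut {Γ : List Pol} (t : Syn Kp Km Γ .ptm) (u : Syn Kp Km Γ .ntm) : Syn Kp Km Γ .cmd

/-- Renamings of term variables. -/
abbrev TRen (Γ Δ : List Pol) : Type := ∀ p : Pol, TVar Γ p → TVar Δ p

/-- A renaming extended under a binder. -/
def TRen.lift {Γ Δ : List Pol} (f : TRen Γ Δ) (q : Pol) : TRen (q :: Γ) (q :: Δ)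
  | _, .zero => .zero
  | p, .succ x => .succ (f p x)

/-- Action of a renaming. -/
def Syn.rename {Kp Km : Type} : {Γ : List Pol} → {s : Cat} → Syn Kp Km Γ s →
    {Δ : List Pol} → TRen Γ Δ → Syn Kp Km Δ s
  | _, _, .pvar x, _, f => .pvar (f _ x)
  | _, _, .pair V W, _, f => .pair (V.rename f) (W.rename f)
  | _, _, .box V, _, f => .box (V.rename f)
  | _, _, .daiP, _, _ => .daiP
  | _, _, .num n, _, _ => .num n
  | _, _, .instrP k, _, _ => .instrP k
  | _, _, .ofVal V, _, f => .ofVal (V.rename f)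
  | _, _, .muNeg c, _, f => .muNeg (c.rename (f.lift _))
  | _, _, .nvar x, _, f => .nvar (f _ x)
  | _, _, .muPair c, _, f => .muPair (c.rename ((f.lift _).lift _))
  | _, _, .muBox c, _, f => .muBox (c.rename (f.lift _))
  | _, _, .muPos c, _, f => .muPos (c.rename (f.lift _))
  | _, _, .daiN, _, _ => .daiN
  | _, _, .instrN k, _, _ => .instrN k
  | _, _, .cut t u, _, f => .cut (t.rename f) (u.rename f)

/-- A variable seen as a value of the same polarity. -/
def Syn.var {Kp Km : Type} {Γ : List Pol} : {p : Pol} → TVar Γ p → Syn Kp Km Γ p.valCat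
  | .pos, x => .pvar x
  | .neg, x => .nvar x

/-- Simultaneous substitutions: every variable is sent to a value of its polarity. -/
abbrev TSub (Kp Km : Type) (Γ Δ : List Pol) : Type :=
  ∀ p : Pol, TVar Γ p → Syn Kp Km Δ p.valCat

/-- A substitution extended under a binder. -/
def TSub.lift {Kp Km : Type} {Γ Δ : List Pol} (f : TSub Kp Km Γ Δ) (q : Pol) :
    TSub Kp Km (q :: Γ) (q :: Δ)
  | _, .zero => Syn.var .zero
  | p, .succ x => (f p x).rename (fun _ y => .succ y)

/-- Capture-avoiding simultaneous substitution. -/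
def Syn.subst {Kp Km : Type} : {Γ : List Pol} → {s : Cat} → Syn Kp Km Γ s →
    {Δ : List Pol} → TSub Kp Km Γ Δ → Syn Kp Km Δ s
  | _, _, .pvar x, _, f => f .pos x
  | _, _, .pair V W, _, f => .pair (V.subst f) (W.subst f)
  | _, _, .box V, _, f => .box (V.subst f)
  | _, _, .daiP, _, _ => .daiP
  | _, _, .num n, _, _ => .num n
  | _, _, .instrP k, _, _ => .instrP k
  | _, _, .ofVal V, _, f => .ofVal (V.subst f)
  | _, _, .muNeg c, _, f => .muNeg (c.subst (f.lift _))
  | _, _, .nvar x, _, f => f .neg x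
  | _, _, .muPair c, _, f => .muPair (c.subst ((f.lift _).lift _))
  | _, _, .muBox c, _, f => .muBox (c.subst (f.lift _))
  | _, _, .muPos c, _, f => .muPos (c.subst (f.lift _))
  | _, _, .daiN, _, _ => .daiN
  | _, _, .instrN k, _, _ => .instrN k
  | _, _, .cut t u, _, f => .cut (t.subst f) (u.subst f)

/-- Closed commands. -/
abbrev Cmd (Kp Km : Type) : Type := Syn Kp Km [] .cmd

/-- Closed terms, of either polarity. -/
inductive Tm (Kp Km : Type) : Type
  | pos (t : Syn Kp Km [] .ptm)
  | neg (t : Syn Kp Km [] .ntm)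

/-- A closed value, seen as a closed term. -/
def Tm.val {Kp Km : Type} : {p : Pol} → Syn Kp Km [] p.valCat → Tm Kp Km
  | .pos, V => .pos (.ofVal V)
  | .neg, t => .neg t

/-- `c[V/κ]` for a closed value `V`. -/
def Syn.inst {Kp Km : Type} {p : Pol} (c : Syn Kp Km [p] .cmd) (V : Syn Kp Km [] p.valCat) :
    Cmd Kp Km :=
  c.subst (fun
    | _, .zero => V
    | _, .succ x => nomatch x)

/-- `c[V/κ, W/κ']` for closed values `V`, `W`. -/
def Syn.inst₂ {Kp Km : Type} {p q : Pol} (c : Syn Kp Km [p, q] .cmd)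
    (V : Syn Kp Km [] p.valCat) (W : Syn Kp Km [] q.valCat) : Cmd Kp Km :=
  c.subst (fun
    | _, .zero => V
    | _, .succ .zero => W
    | _, .succ (.succ x) => nomatch x)

/-! ## Reduction and time -/

/-- The administrative reduction `→_μ`. -/
inductive MuStep {Kp Km : Type} : Cmd Kp Km → Cmd Kp Km → Prop
  | pos (c : Syn Kp Km [.neg] .cmd) (t : Syn Kp Km [] .ntm) :
      MuStep (.cut (.muNeg c) t) (c.inst (p := .neg) t)
  | neg (V : Syn Kp Km [] .pval) (c : Syn Kp Km [.pos] .cmd) :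
      MuStep (.cut (.ofVal V) (.muPos c)) (c.inst (p := .pos) V)

/-- The reduction `→_β`; the polarities of the bound variables and of the values match. -/
inductive BetaStep {Kp Km : Type} : Cmd Kp Km → Cmd Kp Km → Prop
  | box {p : Pol} (V : Syn Kp Km [] p.valCat) (c : Syn Kp Km [p] .cmd) :
      BetaStep (.cut (.ofVal (.box V)) (.muBox c)) (c.inst V)
  | pair {p q : Pol} (V : Syn Kp Km [] p.valCat) (W : Syn Kp Km [] q.valCat)
      (c : Syn Kp Km [p, q] .cmd) :
      BetaStep (.cut (.ofVal (.pair V W)) (.muPair c)) (c.inst₂ V W)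

/-- `RedIn c k c'`: `c` reduces to `c'` for `→_0 = →_β ∪ →_μ` using exactly `k` β-steps. -/
inductive RedIn {Kp Km : Type} : Cmd Kp Km → ℕ → Cmd Kp Km → Prop
  | refl (c : Cmd Kp Km) : RedIn c 0 c
  | mu {c c' c'' : Cmd Kp Km} {k : ℕ} : MuStep c c' → RedIn c' k c'' → RedIn c k c''
  | beta {c c' c'' : Cmd Kp Km} {k : ℕ} : BetaStep c c' → RedIn c' k c'' → RedIn c (k + 1) c''

/-- Normal forms for `→_0`. -/
def IsNormal {Kp Km : Type} (c : Cmd Kp Km) : Prop :=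
  ∀ c' : Cmd Kp Km, ¬ MuStep c c' ∧ ¬ BetaStep c c'

/-- The quantitative pole of the commands that normalise for `→_0` with a bound on the number
of β-steps. -/
def timePole (Kp Km : Type) : Set (Cmd Kp Km × ℕ) :=
  {w | ∃ k : ℕ, k ≤ w.2 ∧ ∃ c' : Cmd Kp Km, RedIn w.1 k c' ∧ IsNormal c'}

/-! ## The countdown machine -/

/-- Negative commands `⟨t^⊖|u⟩`, with `t` a closed term of either polarity and `u` positive. -/
structure NegCmd (Kp Km : Type) where
  /-- the term marked as negative -/
  left : Tm Kp Km
  /-- the positive term it faces -/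
  right : Syn Kp Km [] .ptm

/-- Forcing commands `c{K}`, modulo the identification of `⟨t^⊖|(u, K)⟩` and `⟨u^⊖|(t, K)⟩` for
`t`, `u` of opposite polarities: a class is determined by the command `c = ⟨t|u⟩` and `K`. -/
structure ForcCmd (Kp Km : Type) where
  /-- the underlying command -/
  cmd : Cmd Kp Km
  /-- the third component -/
  arg : Tm Kp Km

/-- `n.Represents f`: the negative command `n` has the form `⟨t^⊖|(u, K)⟩` with `t`, `u` of
opposite polarities, and `f` is the forcing command it denotes. The components of a pair are values;
when `K` is a value, the class `c{K}` always has the representative `⟨t^⊖|(u, K)⟩` with `t`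
positive and `u` negative. -/
inductive NegCmd.Represents {Kp Km : Type} : NegCmd Kp Km → ForcCmd Kp Km → Prop
  | neg {q : Pol} (t : Syn Kp Km [] .ntm) (V : Syn Kp Km [] .pval) (K : Syn Kp Km [] q.valCat) :
      NegCmd.Represents ⟨.neg t, .ofVal (.pair (p := .pos) V K)⟩ ⟨.cut (.ofVal V) t, Tm.val K⟩
  | pos {q : Pol} (t : Syn Kp Km [] .ptm) (u : Syn Kp Km [] .ntm) (K : Syn Kp Km [] q.valCat) :
      NegCmd.Represents ⟨.pos t, .ofVal (.pair (p := .neg) u K)⟩ ⟨.cut t u, Tm.val K⟩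

/-- The closed term which is the primitive integer `n`. -/
def Tm.num {Kp Km : Type} (n : ℕ) : Tm Kp Km := .pos (.ofVal (.num n))

/-- The reduction `→_•` of the countdown machine. -/
inductive CountStep {Kp Km : Type} : ForcCmd Kp Km → ForcCmd Kp Km → Prop
  | muNeg (t : Syn Kp Km [] .ntm) (c : Syn Kp Km [.neg] .cmd) (n : ℕ) :
      CountStep ⟨.cut (.muNeg c) t, Tm.num n⟩ ⟨c.inst (p := .neg) t, Tm.num n⟩
  | muPos (V : Syn Kp Km [] .pval) (c : Syn Kp Km [.pos] .cmd) (n : ℕ) :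
      CountStep ⟨.cut (.ofVal V) (.muPos c), Tm.num n⟩ ⟨c.inst (p := .pos) V, Tm.num n⟩
  | pair {p q : Pol} (V : Syn Kp Km [] p.valCat) (W : Syn Kp Km [] q.valCat)
      (c : Syn Kp Km [p, q] .cmd) (n : ℕ) :
      CountStep ⟨.cut (.ofVal (.pair V W)) (.muPair c), Tm.num (n + 1)⟩
        ⟨c.inst₂ V W, Tm.num n⟩
  | box {p : Pol} (V : Syn Kp Km [] p.valCat) (c : Syn Kp Km [p] .cmd) (n : ℕ) :
      CountStep ⟨.cut (.ofVal (.box V)) (.muBox c), Tm.num (n + 1)⟩ ⟨c.inst V, Tm.num n⟩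

/-- The divergence `⇑_•` of the machine: a β-redex met when the counter is zero. -/
inductive CountDiverges {Kp Km : Type} : ForcCmd Kp Km → Prop
  | pair {p q : Pol} (V : Syn Kp Km [] p.valCat) (W : Syn Kp Km [] q.valCat)
      (c : Syn Kp Km [p, q] .cmd) :
      CountDiverges ⟨.cut (.ofVal (.pair V W)) (.muPair c), Tm.num 0⟩
  | box {p : Pol} (V : Syn Kp Km [] p.valCat) (c : Syn Kp Km [p] .cmd) :
      CountDiverges ⟨.cut (.ofVal (.box V)) (.muBox c), Tm.num 0⟩

/-- The pole of the forcing commands that normalise in the countdown machine. -/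
def countPole (Kp Km : Type) : Set (ForcCmd Kp Km) :=
  {f | ∃ f' : ForcCmd Kp Km, Relation.ReflTransGen CountStep f f' ∧
    (∀ g : ForcCmd Kp Km, ¬ CountStep f' g) ∧ ¬ CountDiverges f'}

/-! ## Orthogonality and propositional domains -/

/-- The data which the realizability interpretation uses: which weighted terms may realise
negative formulas, and which pairs of weighted terms (the first one positive) are orthogonal. -/
structure Duality (Kp Km M : Type) where
  /-- the weighted terms allowed on the negative side -/
  negSide : Set (Tm Kp Km × M)
  /-- `perp x y`: the positive weighted term `x` is orthogonal to `y` -/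
  perp : Tm Kp Km × M → Tm Kp Km × M → Prop

/-- The duality induced by a quantitative pole: `(t, p) ⊥ (u, q)` iff `(⟨t|u⟩, p + q)` is in the
pole, for `t` positive and `u` negative. -/
def quantDuality {Kp Km M : Type} [Add M] (pole : Set (Cmd Kp Km × M)) : Duality Kp Km M where
  negSide := {w | ∃ u, w.1 = Tm.neg u}
  perp x y := ∃ t u, x.1 = Tm.pos t ∧ y.1 = Tm.neg u ∧ (Syn.cut t u, x.2 + y.2) ∈ pole

/-- The duality induced by a set of forcing commands: `u ⊥ t` iff `⟨t^⊖|u⟩` is in the pole, for `u`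
positive and `t` of any polarity. The weights are in the trivial monoid. -/
def countDuality {Kp Km : Type} (pole : Set (ForcCmd Kp Km)) : Duality Kp Km Unit where
  negSide := Set.univ
  perp x y := ∃ u, x.1 = Tm.pos u ∧
    ∃ f ∈ pole, NegCmd.Represents (⟨y.1, u⟩ : NegCmd Kp Km) f

/-- The orthogonal of a set of positive weighted terms. -/
def Duality.orthPos {Kp Km M : Type} (δ : Duality Kp Km M) (X : Set (Tm Kp Km × M)) :
    Set (Tm Kp Km × M) :=
  {y | y ∈ δ.negSide ∧ ∀ x ∈ X, δ.perp x y}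

/-- The orthogonal of a set of weighted terms of the negative side. -/
def Duality.orthNeg {Kp Km M : Type} (δ : Duality Kp Km M) (Y : Set (Tm Kp Km × M)) :
    Set (Tm Kp Km × M) :=
  {x | (∃ t, x.1 = Tm.pos t) ∧ ∀ y ∈ Y, δ.perp x y}

/-- The weighted positive values. -/
def posValues (Kp Km M : Type) : Set (Tm Kp Km × M) :=
  {w | ∃ V : Syn Kp Km [] .pval, w.1 = Tm.pos (.ofVal V)}

/-- `X ⊗ Y`, the set of the `((V, W), p + q)` with `(V, p) ∈ X` and `(W, q) ∈ Y`. -/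
def tensorSet {Kp Km M : Type} [Add M] (X Y : Set (Tm Kp Km × M)) : Set (Tm Kp Km × M) :=
  {w | ∃ (a b : Pol) (V : Syn Kp Km [] a.valCat) (W : Syn Kp Km [] b.valCat) (p q : M),
    (Tm.val V, p) ∈ X ∧ (Tm.val W, q) ∈ Y ∧ w = (Tm.pos (.ofVal (.pair V W)), p + q)}

/-- `↓ X`, the set of the `({V}, p)` with `(V, p) ∈ X`. -/
def downSet {Kp Km M : Type} (X : Set (Tm Kp Km × M)) : Set (Tm Kp Km × M) :=
  {w | ∃ (a : Pol) (V : Syn Kp Km [] a.valCat) (p : M),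
    (Tm.val V, p) ∈ X ∧ w = (Tm.pos (.ofVal (.box V)), p)}

/-- Positive propositional domains: sets of sets of weighted positive values, closed under unions,
non-empty intersections, `⊗` and `↓`, where the arguments of the last two may also be orthogonals of
elements of the domain. -/
structure PropDomain {Kp Km M : Type} [Add M] (δ : Duality Kp Km M) where
  /-- the elements of the domain -/
  carrier : Set (Set (Tm Kp Km × M))
  values : ∀ X ∈ carrier, X ⊆ posValues Kp Km M
  sUnion_mem : ∀ S : Set (Set (Tm Kp Km × M)), S ⊆ carrier → ⋃₀ S ∈ carrier
  sInter_mem : ∀ S : Set (Set (Tm Kp Km × M)), S ⊆ carrier → S.Nonempty → ⋂₀ S ∈ carrier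
  tensor_mem : ∀ X ∈ carrier ∪ δ.orthPos '' carrier, ∀ Y ∈ carrier ∪ δ.orthPos '' carrier,
    tensorSet X Y ∈ carrier
  down_mem : ∀ X ∈ carrier ∪ δ.orthPos '' carrier, downSet X ∈ carrier

/-! ## Kinds and type constructors -/

/-- Kinds: individuals (`ι`), positive and negative formulas, functions. -/
inductive Kd : Type
  | nat
  | o (a : Pol)
  | arr (σ τ : Kd)
  deriving DecidableEq

/-- Negation of kinds. -/
@[reducible] def Kd.dual : Kd → Kd
  | .nat => .nat
  | .o a => .o a.dual
  | .arr σ τ => .arr σ τ.dual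

theorem Kd.dual_dual : ∀ τ : Kd, τ.dual.dual = τ
  | .nat => rfl
  | .o .pos => rfl
  | .o .neg => rfl
  | .arr σ τ => congrArg (Kd.arr σ) (Kd.dual_dual τ)

/-- The kind `τ → (ι → τ → τ) → ι → τ` of the recursor. -/
abbrev Kd.recKd (τ : Kd) : Kd := .arr τ (.arr (.arr .nat (.arr τ τ)) (.arr .nat τ))

/-- Well-kinded type constructors, with additional atomic constants `Q`. A variable is a
name together with its kind. `dvar`, `drecur` and `dconst` are the negations of the atoms, and
`eqImp T U A` is the equational implication `⟨T = U⟩ A`. -/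
inductive TyCon (Q : Kd → Type) : Kd → Type
  | var (x : ℕ) (τ : Kd) : TyCon Q τ
  | dvar (x : ℕ) (τ : Kd) : TyCon Q τ.dual
  | lam (x : ℕ) (σ : Kd) {τ : Kd} (T : TyCon Q τ) : TyCon Q (.arr σ τ)
  | app {σ τ : Kd} (T : TyCon Q (.arr σ τ)) (U : TyCon Q σ) : TyCon Q τ
  | zero : TyCon Q .nat
  | succ : TyCon Q (.arr .nat .nat)
  | recur (τ : Kd) : TyCon Q τ.recKd
  | drecur (τ : Kd) : TyCon Q τ.recKd.dual
  | const {τ : Kd} (k : Q τ) : TyCon Q τ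
  | dconst {τ : Kd} (k : Q τ) : TyCon Q τ.dual
  | tensor {a b : Pol} (A : TyCon Q (.o a)) (B : TyCon Q (.o b)) : TyCon Q (.o .pos)
  | par {a b : Pol} (A : TyCon Q (.o a)) (B : TyCon Q (.o b)) : TyCon Q (.o .neg)
  | ex (x : ℕ) (σ : Kd) {a : Pol} (A : TyCon Q (.o a)) : TyCon Q (.o a)
  | all (x : ℕ) (σ : Kd) {a : Pol} (A : TyCon Q (.o a)) : TyCon Q (.o a)
  | down {a : Pol} (A : TyCon Q (.o a)) : TyCon Q (.o .pos)
  | up {a : Pol} (A : TyCon Q (.o a)) : TyCon Q (.o .neg)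
  | eqImp {τ : Kd} {a : Pol} (T U : TyCon Q τ) (A : TyCon Q (.o a)) : TyCon Q (.o a)

/-- Negation of constructors. -/
def TyCon.neg {Q : Kd → Type} : {τ : Kd} → TyCon Q τ → TyCon Q τ.dual
  | _, .var x τ => .dvar x τ
  | _, .dvar x τ => cast (congrArg (TyCon Q) τ.dual_dual.symm) (TyCon.var x τ)
  | _, .lam x σ T => .lam x σ T.neg
  | _, .app (σ := σ) (τ := τ) T U => .app (σ := σ) (τ := τ.dual) T.neg U
  | _, .zero => .zero
  | _, .succ => .succ
  | _, .recur τ => .drecur τ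
  | _, .drecur τ => cast (congrArg (TyCon Q) τ.recKd.dual_dual.symm) (TyCon.recur τ)
  | _, .const k => .dconst k
  | _, .dconst (τ := τ) k => cast (congrArg (TyCon Q) τ.dual_dual.symm) (TyCon.const k)
  | _, .tensor (a := a) (b := b) A B => .par (a := a.dual) (b := b.dual) A.neg B.neg
  | _, .par (a := a) (b := b) A B => .tensor (a := a.dual) (b := b.dual) A.neg B.neg
  | _, .ex x σ (a := a) A => .all x σ (a := a.dual) A.neg
  | _, .all x σ (a := a) A => .ex x σ (a := a.dual) A.neg
  | _, .down (a := a) A => .up (a := a.dual) A.neg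
  | _, .up (a := a) A => .down (a := a.dual) A.neg
  | _, .eqImp (a := a) T U A => .eqImp (a := a.dual) T U A.neg

/-- Call-by-name linear implication `A ⊸ B = A^⊥ ⅋ B`. -/
def TyCon.limp {Q : Kd → Type} {a b : Pol} (A : TyCon Q (.o a)) (B : TyCon Q (.o b)) :
    TyCon Q (.o .neg) :=
  .par (a := a.dual) A.neg B

/-- The individual `s^n 0`. -/
def TyCon.numeral {Q : Kd → Type} : ℕ → TyCon Q .nat
  | 0 => .zero
  | n + 1 => .app .succ (TyCon.numeral n)

/-! ## Interpretation of kinds and constructors -/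

section Interpretation

variable {Kp Km M : Type} [Add M] {δ : Duality Kp Km M}

/-- Elements of `𝒟⊖`: the orthogonals of the elements of `𝒟⊕`, given together with the element
of which they are the orthogonal, so that `⊥(X^⊥, o⁻) = X` is well defined. -/
structure NegElem (D : PropDomain δ) where
  /-- the negative set -/
  set : Set (Tm Kp Km × M)
  /-- the positive set of which it is the orthogonal -/
  pre : Set (Tm Kp Km × M)
  pre_mem : pre ∈ D.carrier
  set_eq : set = δ.orthPos pre

/-- Interpretation of kinds. -/
@[reducible] def Sem (D : PropDomain δ) : Kd → Type
  | .nat => ℕ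
  | .o .pos => {X : Set (Tm Kp Km × M) // X ∈ D.carrier}
  | .o .neg => NegElem D
  | .arr σ τ => Sem D σ → Sem D τ

/-- The set of weighted terms given by an element of the interpretation of `o⁺` or `o⁻`. -/
def Sem.toSet {D : PropDomain δ} : {a : Pol} → Sem D (.o a) → Set (Tm Kp Km × M)
  | .pos, X => Subtype.val X
  | .neg, Y => NegElem.set Y

/-- The positive element `∅`. -/
def Sem.empty (D : PropDomain δ) : Sem D (.o .pos) :=
  ⟨∅, by simpa using D.sUnion_mem ∅ (Set.empty_subset _)⟩

/-- The orthogonal of a positive element, as a negative element. -/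
def Sem.orth {D : PropDomain δ} (X : Sem D (.o .pos)) : Sem D (.o .neg) :=
  NegElem.mk (δ.orthPos X.1) X.1 X.2 rfl

instance Sem.nonempty (D : PropDomain δ) : ∀ τ : Kd, Nonempty (Sem D τ)
  | .nat => ⟨(0 : ℕ)⟩
  | .o .pos => ⟨Sem.empty D⟩
  | .o .neg => ⟨Sem.orth (Sem.empty D)⟩
  | .arr σ τ => (Sem.nonempty D τ).map (fun (v : Sem D τ) => (fun _ : Sem D σ => v))

/-- Orthogonality extended to all kinds. -/
def Sem.bot {D : PropDomain δ} : (τ : Kd) → Sem D τ → Sem D τ.dual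
  | .nat, n => n
  | .o .pos, X => Sem.orth X
  | .o .neg, Y => ⟨NegElem.pre Y, NegElem.pre_mem Y⟩
  | .arr _ τ, f => fun v => Sem.bot τ (f v)

theorem Sem.toSet_mem {D : PropDomain δ} : ∀ {a : Pol} (X : Sem D (.o a)),
    X.toSet ∈ D.carrier ∪ δ.orthPos '' D.carrier
  | .pos, X => Or.inl X.2
  | .neg, Y => Or.inr ⟨NegElem.pre Y, NegElem.pre_mem Y, (NegElem.set_eq Y).symm⟩

/-- Interpretation of `⊗`. -/
def Sem.tensor {D : PropDomain δ} {a b : Pol} (X : Sem D (.o a)) (Y : Sem D (.o b)) :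
    Sem D (.o .pos) :=
  ⟨tensorSet X.toSet Y.toSet, D.tensor_mem _ X.toSet_mem _ Y.toSet_mem⟩

/-- Interpretation of `↓`. -/
def Sem.down {D : PropDomain δ} {a : Pol} (X : Sem D (.o a)) : Sem D (.o .pos) :=
  ⟨downSet X.toSet, D.down_mem _ X.toSet_mem⟩

/-- The union of a family of positive elements. -/
def Sem.iUnion {D : PropDomain δ} {I : Type} (F : I → Sem D (.o .pos)) : Sem D (.o .pos) :=
  ⟨⋃ i, (F i).toSet, D.sUnion_mem (Set.range fun i => (F i).toSet)
    (Set.range_subset_iff.2 fun i => (F i).2)⟩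

/-- The intersection of a non-empty family of positive elements. -/
def Sem.iInter {D : PropDomain δ} {I : Type} [Nonempty I] (F : I → Sem D (.o .pos)) :
    Sem D (.o .pos) :=
  ⟨⋂ i, (F i).toSet, D.sInter_mem (Set.range fun i => (F i).toSet)
    (Set.range_subset_iff.2 fun i => (F i).2) (Set.range_nonempty _)⟩

/-- Interpretation of `∃`: the union, and for a negative formula `(⋂ |N^⊥|)^⊥`. -/
def Sem.ex {D : PropDomain δ} {I : Type} [Nonempty I] :
    {a : Pol} → (I → Sem D (.o a)) → Sem D (.o a)
  | .pos, F => Sem.iUnion F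
  | .neg, F => Sem.orth (Sem.iInter fun i => Sem.bot (.o .neg) (F i))

/-- Interpretation of `∀`: the intersection, and for a negative formula `(⋃ |N^⊥|)^⊥`. -/
def Sem.all {D : PropDomain δ} {I : Type} [Nonempty I] :
    {a : Pol} → (I → Sem D (.o a)) → Sem D (.o a)
  | .pos, F => Sem.iInter F
  | .neg, F => Sem.orth (Sem.iUnion fun i => Sem.bot (.o .neg) (F i))

/-- The value of an equational implication whose equation fails: `∅` for a positive formula,
and `∅^⊥` for a negative one. -/
def Sem.absent (D : PropDomain δ) : (a : Pol) → Sem D (.o a)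
  | .pos => Sem.empty D
  | .neg => Sem.orth (Sem.empty D)

/-- Total valuations. -/
abbrev Valn (D : PropDomain δ) : Type := ∀ τ : Kd, ℕ → Sem D τ

/-- The valuation `ρ[x^σ ← v]`. -/
def Valn.update {D : PropDomain δ} (ρ : Valn D) (x : ℕ) (σ : Kd) (v : Sem D σ) :
    Valn D :=
  fun τ y => if h : σ = τ ∧ x = y then cast (congrArg (Sem D) h.1) v else ρ τ y

/-- The recursor on natural numbers. -/
def Sem.recur (D : PropDomain δ) (τ : Kd) : Sem D τ.recKd :=
  fun (z : Sem D τ) (f : ℕ → Sem D τ → Sem D τ) (n : ℕ) =>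
    Nat.rec (motive := fun _ => Sem D τ) z f n

open Classical in
/-- Interpretation `|T|_ρ` of constructors, given an interpretation `J` of the constants. The
interpretation of `A^⊥` is that of `A` transformed by `Sem.bot`. -/
noncomputable def TyCon.interp {D : PropDomain δ} {Q : Kd → Type}
    (J : ∀ τ : Kd, Q τ → Sem D τ) : {τ : Kd} → TyCon Q τ → Valn D → Sem D τ
  | _, .var x τ, ρ => ρ τ x
  | _, .dvar x τ, ρ => Sem.bot τ (ρ τ x)
  | _, .lam x σ T, ρ => fun v => T.interp J (ρ.update x σ v)
  | _, .app T U, ρ => (T.interp J ρ : Sem D _ → Sem D _) (U.interp J ρ)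
  | _, .zero, _ => (0 : ℕ)
  | _, .succ, _ => Nat.succ
  | _, .recur τ, _ => Sem.recur D τ
  | _, .drecur τ, _ => Sem.bot τ.recKd (Sem.recur D τ)
  | _, .const k, _ => J _ k
  | _, .dconst k, _ => Sem.bot _ (J _ k)
  | _, .tensor A B, ρ => Sem.tensor (A.interp J ρ) (B.interp J ρ)
  | _, .par (a := a) (b := b) A B, ρ =>
      Sem.orth (Sem.tensor (a := a.dual) (b := b.dual)
        (Sem.bot (.o a) (A.interp J ρ)) (Sem.bot (.o b) (B.interp J ρ)))
  | _, .ex x σ A, ρ => Sem.ex fun v : Sem D σ => A.interp J (ρ.update x σ v)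
  | _, .all x σ A, ρ => Sem.all fun v : Sem D σ => A.interp J (ρ.update x σ v)
  | _, .down A, ρ => Sem.down (A.interp J ρ)
  | _, .up (a := a) A, ρ =>
      Sem.orth (Sem.down (a := a.dual) (Sem.bot (.o a) (A.interp J ρ)))
  | _, .eqImp (a := a) T U A, ρ =>
      if T.interp J ρ = U.interp J ρ then A.interp J ρ else Sem.absent D a

/-- The biorthogonal of the set given by an element of the interpretation of `o⁺` or `o⁻`. -/
def Sem.biorth {D : PropDomain δ} : {a : Pol} → Sem D (.o a) → Set (Tm Kp Km × M)
  | .pos, X => δ.orthNeg (δ.orthPos X.toSet)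
  | .neg, Y => δ.orthPos (δ.orthNeg Y.toSet)

/-- `w` realises the formula `A`: it belongs to the biorthogonal of `|A|_ρ`. -/
def Realizes {D : PropDomain δ} {Q : Kd → Type} (J : ∀ τ : Kd, Q τ → Sem D τ)
    (ρ : Valn D) (w : Tm Kp Km × M) {a : Pol} (A : TyCon Q (.o a)) : Prop :=
  w ∈ (A.interp J ρ).biorth

end Interpretation

/-! ## Formulas and the forcing translation -/

/-- Formulas of multiplicative affine logic, indexed by their polarity. -/
inductive MAL : Pol → Type
  | var (X : ℕ) : MAL .pos
  | dvar (X : ℕ) : MAL .neg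
  | tensor {a b : Pol} (A : MAL a) (B : MAL b) : MAL .pos
  | par {a b : Pol} (A : MAL a) (B : MAL b) : MAL .neg
  | down {a : Pol} (A : MAL a) : MAL .pos
  | up {a : Pol} (A : MAL a) : MAL .neg

/-- Negation of formulas. -/
def MAL.neg : {a : Pol} → MAL a → MAL a.dual
  | _, .var X => .dvar X
  | _, .dvar X => .var X
  | _, .tensor A B => .par A.neg B.neg
  | _, .par A B => .tensor A.neg B.neg
  | _, .down A => .up A.neg
  | _, .up A => .down A.neg

/-- Number of connectives of a formula. -/
def MAL.size : {a : Pol} → MAL a → ℕ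
  | _, .var _ => 0
  | _, .dvar _ => 0
  | _, .tensor A B => A.size + B.size + 1
  | _, .par A B => A.size + B.size + 1
  | _, .down A => A.size + 1
  | _, .up A => A.size + 1

theorem MAL.size_neg {a : Pol} (A : MAL a) : A.neg.size = A.size := by
  induction A <;> simp_all [MAL.neg, MAL.size]

/-- No additional constants. -/
inductive NoConst : Kd → Type

/-- The interpretation of no constant at all. -/
def NoConst.interp {Kp Km M : Type} [Add M] {δ : Duality Kp Km M} (D : PropDomain δ) :
    ∀ τ : Kd, NoConst τ → Sem D τ :=
  fun _ k => nomatch k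

/-- A formula seen as a type constructor; `X` becomes the variable `X` of kind `o⁺`. -/
def MAL.toCon : {a : Pol} → MAL a → TyCon NoConst (.o a)
  | _, .var X => .var X (.o .pos)
  | _, .dvar X => .dvar X (.o .pos)
  | _, .tensor A B => .tensor A.toCon B.toCon
  | _, .par A B => .par A.toCon B.toCon
  | _, .down A => .down A.toCon
  | _, .up A => .up A.toCon

/-- The additional predicate `𝒞[.]` on conditions, of kind `ι → o⁺`. -/
inductive CondConst : Kd → Type
  | C : CondConst (.arr .nat (.o .pos))

/-- Addition of conditions, `λ p. λ q. rec p (λ z. s) q`. -/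
def condAdd : TyCon CondConst (.arr .nat (.arr .nat .nat)) :=
  .lam 0 .nat (.lam 1 .nat
    (.app (.app (.app (.recur .nat) (.var 0 .nat)) (.lam 2 .nat .succ)) (.var 1 .nat)))

/-- The formula `𝒞[p]`. -/
def condAt (p : TyCon CondConst .nat) : TyCon CondConst (.o .pos) := .app (.const .C) p

/-- The forcing orthogonal `λ r. ∀ r'. Z(r') ⊸ 𝒞[r + r']^⊥`, for a predicate `Z` in which the
variables `0` and `1` of kind `ι` are not free. -/
def forcOrth {a : Pol} (Z : TyCon CondConst (.arr .nat (.o a))) :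
    TyCon CondConst (.arr .nat (.o .neg)) :=
  .lam 0 .nat (.all 1 .nat
    (TyCon.limp (b := .neg) (.app Z (.var 1 .nat))
      (TyCon.neg (condAt (.app (.app condAdd (.var 0 .nat)) (.var 1 .nat))))))

/-- `λ r. ∃ p₁. ∃ p₂. ⟨r = p₁ + p₂⟩ (Y(p₁) ⊗ Z(p₂))`, for predicates `Y`, `Z` in which the variables
`0`, `1` and `2` of kind `ι` are not free. -/
def forcTensor {a b : Pol} (Y : TyCon CondConst (.arr .nat (.o a)))
    (Z : TyCon CondConst (.arr .nat (.o b))) : TyCon CondConst (.arr .nat (.o .pos)) :=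
  .lam 0 .nat (.ex 1 .nat (.ex 2 .nat
    (.eqImp (.var 0 .nat) (.app (.app condAdd (.var 1 .nat)) (.var 2 .nat))
      (.tensor (.app Y (.var 1 .nat)) (.app Z (.var 2 .nat))))))

/-- `λ r. ↓ Z(r)`, for a predicate `Z` in which the variable `0` of kind `ι` is not free. -/
def forcDown {a : Pol} (Z : TyCon CondConst (.arr .nat (.o a))) :
    TyCon CondConst (.arr .nat (.o .pos)) :=
  .lam 0 .nat (.down (.app Z (.var 0 .nat)))

/-- The forcing translation `A*`; `X` becomes the variable `X` of kind `ι → o⁺`. The predicates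
`A*` have no free variable of kind `ι`. -/
def MAL.star : {a : Pol} → MAL a → TyCon CondConst (.arr .nat (.o a))
  | _, .var X => .var X (.arr .nat (.o .pos))
  | _, .dvar X => forcOrth (.var X (.arr .nat (.o .pos)))
  | _, .tensor A B => forcTensor A.star B.star
  | _, .par A B => forcOrth (forcTensor A.neg.star B.neg.star)
  | _, .down A => forcDown A.star
  | _, .up A => forcOrth (forcDown A.neg.star)
termination_by _ A => A.size
decreasing_by all_goals simp only [MAL.size, MAL.size_neg]; omega

/-- The formula `p ⊩_f A`. -/
def forces (p : TyCon CondConst .nat) : {a : Pol} → MAL a → TyCon CondConst (.o .neg)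
  | .pos, P => .app (forcOrth (forcOrth P.star)) p
  | .neg, N => .app N.star p

/-! ## The two models -/

/-- The set `{ n̄ | p ≤ n }` which interprets `𝒞[p]`. -/
def condSet (Kp Km : Type) (p : ℕ) : Set (Tm Kp Km × Unit) :=
  {w | ∃ n : ℕ, p ≤ n ∧ w.1 = Tm.num n}

/-- The interpretation of `𝒞[.]`, in a domain that contains the sets `{ n̄ | p ≤ n }`. -/
def CondConst.interp {Kp Km : Type} {δ : Duality Kp Km Unit} (D : PropDomain δ)
    (hD : ∀ p : ℕ, condSet Kp Km p ∈ D.carrier) : ∀ τ : Kd, CondConst τ → Sem D τ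
  | _, .C => fun p : ℕ => ⟨condSet Kp Km p, hD p⟩

/-- The closed positive term `dai₊`. -/
def Tm.dai {Kp Km : Type} : Tm Kp Km := .pos (.ofVal .daiP)

/-- The duality of the bounded-time model. -/
abbrev timeDuality (Kp Km : Type) : Duality Kp Km ℕ := quantDuality (timePole Kp Km)

/-- The duality of the countdown reducibility-candidates model. -/
abbrev normDuality (Kp Km : Type) : Duality Kp Km Unit := countDuality (countPole Kp Km)

/-! ## The countdown machine measures β-steps -/

/-! The counter of the machine goes down exactly at β-steps, so `c{m̄}` normalizes iff `c`
normalizes with at most `m` β-steps (`mem_countPole_iff`). Being orthogonal to a pair `(V, m̄)` in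
the countdown model is therefore being orthogonal to `V` in the time model with total weight `m`.

Cut a set of weighted terms `X` into its slices of weight `p`. The forcing orthogonal at `r` tests a
term against all pairs `(V, m̄)` with `V` of weight `r'` and `r + r' ≤ m`; since the time pole is
upward closed in the weight, only `m = r + r'` matters. Hence the slices of an orthogonal are the
forcing orthogonal of the slices (`weightSlice_orthPos`, `weightSlice_orthNeg`). This fails for `X =
∅`, whose orthogonal contains terms of one polarity in the time model and of both in the countdown
model; but every MAL formula is inhabited, thanks to the two constants `✠`.

Slices commute with `⊗` and `↓` as the translation prescribes, and `⅋` and `↑` are orthogonals of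
positive formulas. By induction, `A*` at `p` is the slice of weight `p` of `|A|`
(`MAL.star_interp`). Negative sets are biorthogonally closed, which settles negative formulas; for a
positive formula, the two forcing orthogonals in `n ⊩_f A` compute the slice of `|A|^⊥⊥`. -/

theorem CountStep.of_muStep {Kp Km : Type} {c c' : Cmd Kp Km} (h : MuStep c c') (m : ℕ) :
    CountStep ⟨c, Tm.num m⟩ ⟨c', Tm.num m⟩ := by
  cases h with
  | pos c t => exact .muNeg t c m
  | neg V c => exact .muPos V c m

theorem CountStep.of_betaStep {Kp Km : Type} {c c' : Cmd Kp Km} (h : BetaStep c c') (m : ℕ) :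
    CountStep ⟨c, Tm.num (m + 1)⟩ ⟨c', Tm.num m⟩ := by
  cases h with
  | box V c => exact .box V c m
  | pair V W c => exact .pair V W c m

theorem CountDiverges.of_betaStep {Kp Km : Type} {c c' : Cmd Kp Km} (h : BetaStep c c') :
    CountDiverges ⟨c, Tm.num 0⟩ := by
  cases h with
  | box V c => exact .box V c
  | pair V W c => exact .pair V W c

theorem Tm.num_injective {Kp Km : Type} : Function.Injective (Tm.num (Kp := Kp) (Km := Km)) := by
  intro m n h
  simpa [Tm.num] using h

/-- Every step of the countdown machine is a `μ`-step or a `β`-step. -/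
theorem CountStep.elim {Kp Km : Type} {f g : ForcCmd Kp Km} (h : CountStep f g) :
    ∃ m : ℕ, (f.arg = Tm.num m ∧ g.arg = Tm.num m ∧ MuStep f.cmd g.cmd) ∨
      (f.arg = Tm.num (m + 1) ∧ g.arg = Tm.num m ∧ BetaStep f.cmd g.cmd) := by
  cases h with
  | muNeg t c n => exact ⟨n, .inl ⟨rfl, rfl, .pos c t⟩⟩
  | muPos V c n => exact ⟨n, .inl ⟨rfl, rfl, .neg V c⟩⟩
  | pair V W c n => exact ⟨n, .inr ⟨rfl, rfl, .pair V W c⟩⟩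
  | box V c n => exact ⟨n, .inr ⟨rfl, rfl, .box V c⟩⟩

theorem CountDiverges.elim {Kp Km : Type} {f : ForcCmd Kp Km} (h : CountDiverges f) :
    ∃ c', BetaStep f.cmd c' := by
  cases h with
  | pair V W c => exact ⟨_, .pair V W c⟩
  | box V c => exact ⟨_, .box V c⟩

/-- A command normalises in the countdown machine from `m` if and only if it normalises for `→_0`
with at most `m` β-steps. -/
theorem mem_countPole_iff {Kp Km : Type} (c : Cmd Kp Km) (m : ℕ) :
    (⟨c, Tm.num m⟩ : ForcCmd Kp Km) ∈ countPole Kp Km ↔ (c, m) ∈ timePole Kp Km := by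
  constructor
  · rintro ⟨f', hred, hnf, hdiv⟩
    -- The counter varies along the reduction, so the induction must leave it free; only the
    -- endpoint is fixed.
    suffices H : ∀ f, Relation.ReflTransGen CountStep f f' → ∀ m, f.arg = Tm.num m →
        (f.cmd, m) ∈ timePole Kp Km from H _ hred m rfl
    intro f h
    induction h using Relation.ReflTransGen.head_induction_on with
    | refl =>
      obtain ⟨c', K⟩ := f'
      rintro m rfl
      refine ⟨0, Nat.zero_le _, c', .refl c', fun d => ⟨fun h => ?_, fun h => ?_⟩⟩
      · exact hnf _ (CountStep.of_muStep h m)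
      -- At counter zero a β-redex does not step: it is excluded by non-divergence instead.
      · cases m with
        | zero => exact hdiv (CountDiverges.of_betaStep h)
        | succ m => exact hnf _ (CountStep.of_betaStep h m)
    | head hstep _ ih =>
      intro m hm
      obtain ⟨l, ⟨h₁, h₂, h₃⟩ | ⟨h₁, h₂, h₃⟩⟩ := hstep.elim <;>
        obtain ⟨k, hk, c', hr, hn⟩ := ih _ h₂ <;>
        obtain rfl := Tm.num_injective (hm.symm.trans h₁)
      · exact ⟨k, hk, c', .mu h₃ hr, hn⟩
      · exact ⟨k + 1, Nat.succ_le_succ hk, c', .beta h₃ hr, hn⟩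
  · rintro ⟨k, hk, c', hred, hn⟩
    -- Since `k ≤ m`, the subtraction is not truncated and the counter never runs out before the
    -- normal form.
    have H : Relation.ReflTransGen CountStep (⟨c, Tm.num m⟩ : ForcCmd Kp Km)
        ⟨c', Tm.num (m - k)⟩ := by
      dsimp only at hk hred
      clear hn
      induction hred generalizing m with
      | refl => exact .refl
      | mu h _ ih => exact .head (CountStep.of_muStep h m) (ih _ hk)
      | beta h _ ih =>
        obtain ⟨m, rfl⟩ : ∃ l, m = l + 1 := ⟨m - 1, by omega⟩
        refine .head (CountStep.of_betaStep h m) ?_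
        rw [Nat.add_sub_add_right]
        exact ih _ (Nat.le_of_succ_le_succ hk)
    refine ⟨_, H, fun g hg => ?_, fun hd => ?_⟩
    · obtain ⟨_, ⟨_, _, h⟩ | ⟨_, _, h⟩⟩ := hg.elim
      exacts [(hn _).1 h, (hn _).2 h]
    · obtain ⟨_, h⟩ := hd.elim
      exact (hn _).2 h

theorem timePole_mono {Kp Km : Type} {c : Cmd Kp Km} {m n : ℕ} (h : (c, m) ∈ timePole Kp Km)
    (hmn : m ≤ n) : (c, n) ∈ timePole Kp Km := by
  obtain ⟨k, hk, hc⟩ := h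
  exact ⟨k, hk.trans hmn, hc⟩

theorem cut_daiN_mem_timePole {Kp Km : Type} (V : Syn Kp Km [] .pval) (m : ℕ) :
    (Syn.cut (.ofVal V) .daiN, m) ∈ timePole Kp Km :=
  ⟨0, Nat.zero_le _, _, .refl _, fun _ => ⟨nofun, nofun⟩⟩

/-! ## Orthogonality to a pair whose second component is a primitive integer -/

/-- The polarity of the first component decides which of the two denotations of a forcing command
applies, hence the polarity of `t`; the rest is `mem_countPole_iff`. -/
theorem normDuality_perp_pair_pos {Kp Km : Type} (V : Syn Kp Km [] .pval) (m : ℕ)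
    (t : Tm Kp Km) :
    (normDuality Kp Km).perp (.pos (.ofVal (.pair (p := .pos) (q := .pos) V (.num m))), ())
        (t, ()) ↔
      ∃ u, t = .neg u ∧ (Syn.cut (.ofVal V) u, m) ∈ timePole Kp Km := by
  constructor
  · rintro ⟨_, ⟨rfl⟩, f, hf, hr⟩
    cases hr with
    | neg u => exact ⟨u, rfl, (mem_countPole_iff _ _).1 hf⟩
  · rintro ⟨u, rfl, h⟩
    exact ⟨_, rfl, _, (mem_countPole_iff _ _).2 h, .neg (q := .pos) u V (.num m)⟩

theorem normDuality_perp_pair_neg {Kp Km : Type} (u : Syn Kp Km [] .ntm) (m : ℕ)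
    (t : Tm Kp Km) :
    (normDuality Kp Km).perp (.pos (.ofVal (.pair (p := .neg) (q := .pos) u (.num m))), ())
        (t, ()) ↔
      ∃ s, t = .pos s ∧ (Syn.cut s u, m) ∈ timePole Kp Km := by
  constructor
  · rintro ⟨_, ⟨rfl⟩, f, hf, hr⟩
    cases hr with
    | pos s => exact ⟨s, rfl, (mem_countPole_iff _ _).1 hf⟩
  · rintro ⟨s, rfl, h⟩
    exact ⟨_, rfl, _, (mem_countPole_iff _ _).2 h, .pos (q := .pos) s u (.num m)⟩

/-- The realisers of the forcing orthogonal of the family `Z`, at the condition `r`. -/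
def forcOrthSet {Kp Km : Type} (Z : ℕ → Set (Tm Kp Km × Unit)) (r : ℕ) :
    Set (Tm Kp Km × Unit) :=
  (normDuality Kp Km).orthPos (⋃ r', tensorSet (Z r') (condSet Kp Km (r + r')))

theorem mem_forcOrthSet {Kp Km : Type} {Z : ℕ → Set (Tm Kp Km × Unit)} {r : ℕ}
    {t : Tm Kp Km} :
    (t, ()) ∈ forcOrthSet Z r ↔
      ∀ (a : Pol) (V : Syn Kp Km [] a.valCat) (r' m : ℕ), (Tm.val V, ()) ∈ Z r' → r + r' ≤ m →
        (normDuality Kp Km).perp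
          (.pos (.ofVal (.pair (p := a) (q := .pos) V (.num m))), ()) (t, ()) := by
  constructor
  · rintro ⟨-, h⟩ a V r' m hV hm
    exact h _ (Set.mem_iUnion.2 ⟨r', a, .pos, V, .num m, (), (), hV, ⟨m, hm, rfl⟩, rfl⟩)
  · refine fun h => ⟨trivial, fun x hx => ?_⟩
    obtain ⟨r', a, b, V, W, _, _, hV, ⟨m, hm, hW⟩, rfl⟩ := Set.mem_iUnion.1 hx
    -- Primitive integers are positive values, so the second component cannot be negative.
    cases b with
    | neg => cases hW
    | pos =>
      cases hW
      exact h a V r' m hV hm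

/-- Larger integers than `r + r'` give no new constraint, by `timePole_mono`. Non-emptiness supplies
one test, which forces `t` to be negative; without it the right-hand side would accept every term.
-/
theorem mem_timeDuality_orthPos_iff {Kp Km : Type} {X : Set (Tm Kp Km × ℕ)}
    {Z : ℕ → Set (Tm Kp Km × Unit)} (hZ : ∀ t p, (t, p) ∈ X ↔ (t, ()) ∈ Z p)
    (hX : X ⊆ posValues Kp Km ℕ) (hne : X.Nonempty) (t : Tm Kp Km) (r : ℕ) :
    (t, r) ∈ (timeDuality Kp Km).orthPos X ↔ (t, ()) ∈ forcOrthSet Z r := by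
  rw [mem_forcOrthSet]
  constructor
  · rintro ⟨-, h⟩ a V r' m hV hm
    have hV' := (hZ _ _).2 hV
    cases a with
    | neg => obtain ⟨_, ⟨⟩⟩ := hX hV'
    | pos =>
      obtain ⟨_, u, ⟨rfl⟩, hu, hp⟩ := h _ hV'
      dsimp only at hu hp
      exact (normDuality_perp_pair_pos V m t).2 ⟨u, hu, timePole_mono hp (by omega)⟩
  · intro h
    have key : ∀ x ∈ X, ∃ s u, x.1 = .pos s ∧ t = .neg u ∧
        (Syn.cut s u, x.2 + r) ∈ timePole Kp Km := by
      rintro ⟨s, p⟩ hx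
      obtain ⟨V, ⟨rfl⟩⟩ := hX hx
      -- The least integer allowed by `𝒞[r + p]` gives the sharp bound.
      obtain ⟨u, hu, hp⟩ := (normDuality_perp_pair_pos V _ t).1
        (h .pos V p (p + r) ((hZ _ _).1 hx) (by omega))
      exact ⟨_, u, rfl, hu, hp⟩
    obtain ⟨x, hx⟩ := hne
    obtain ⟨_, u, -, hu, -⟩ := key x hx
    exact ⟨⟨u, hu⟩, key⟩

/-- The same forcing orthogonal also computes orthogonals in the other direction, because the
negative side of the countdown model admits terms of both polarities. -/
theorem mem_timeDuality_orthNeg_iff {Kp Km : Type} {Y : Set (Tm Kp Km × ℕ)}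
    {Z : ℕ → Set (Tm Kp Km × Unit)} (hZ : ∀ t p, (t, p) ∈ Y ↔ (t, ()) ∈ Z p)
    (hY : Y ⊆ (timeDuality Kp Km).negSide) (hne : Y.Nonempty) (t : Tm Kp Km) (r : ℕ) :
    (t, r) ∈ (timeDuality Kp Km).orthNeg Y ↔ (t, ()) ∈ forcOrthSet Z r := by
  rw [mem_forcOrthSet]
  constructor
  · rintro ⟨-, h⟩ a V r' m hV hm
    have hV' := (hZ _ _).2 hV
    cases a with
    | pos => obtain ⟨_, ⟨⟩⟩ := hY hV'
    | neg =>
      obtain ⟨s, _, hs, ⟨rfl⟩, hp⟩ := h _ hV'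
      dsimp only at hs hp
      exact (normDuality_perp_pair_neg V m t).2 ⟨s, hs, timePole_mono hp (by omega)⟩
  · intro h
    have key : ∀ y ∈ Y, ∃ s u, t = .pos s ∧ y.1 = .neg u ∧
        (Syn.cut s u, r + y.2) ∈ timePole Kp Km := by
      rintro ⟨_, p⟩ hy
      obtain ⟨u, ⟨rfl⟩⟩ := hY hy
      obtain ⟨s, hs, hp⟩ := (normDuality_perp_pair_neg u _ t).1
        (h .neg u p (r + p) ((hZ _ _).1 hy) le_rfl)
      exact ⟨s, u, hs, rfl, hp⟩
    obtain ⟨y, hy⟩ := hne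
    obtain ⟨s, _, hs, -, -⟩ := key y hy
    exact ⟨⟨s, hs⟩, key⟩

/-- Triple orthogonals of sets of positive values are orthogonals. -/
theorem Duality.orthPos_orthNeg_orthPos {Kp Km M : Type} {δ : Duality Kp Km M} {X : Set (Tm Kp Km × M)}
    (hX : X ⊆ posValues Kp Km M) :
    δ.orthPos (δ.orthNeg (δ.orthPos X)) = δ.orthPos X := by
  ext y
  refine ⟨fun h => ⟨h.1, fun x hx => h.2 x ⟨?_, fun z hz => hz.2 x hx⟩⟩,
    fun h => ⟨h.1, fun x hx => hx.2 y h⟩⟩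
  -- `orthNeg` only contains positive terms, so `X ⊆ X^⊥⊥` needs the elements of `X` to be positive.
  obtain ⟨V, hV⟩ := hX hx
  exact ⟨_, hV⟩

/-! ### Semantics of negation, valuations and arithmetic -/

section NegationInterpretation

variable {Kp Km M : Type} [Add M] {δ : Duality Kp Km M} {D : PropDomain δ}

/-- A negative element remembers the positive set it comes from, so no biorthogonal closure appears.
-/
theorem Sem.bot_pos_bot_neg (Y : Sem D (.o .neg)) :
    Sem.bot (.o .pos) (Sem.bot (.o .neg) Y) = Y := by
  obtain ⟨S, X, hX, rfl⟩ := Y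
  rfl

/-- Double negation of kinds is only a propositional equality, so at arrow kinds its transport has
to be pushed into the codomain. -/
theorem Sem.cast_arr {σ τ τ' : Kd} (h : τ = τ') (f : Sem D σ → Sem D τ) :
    (cast (congrArg (fun κ => Sem D (.arr σ κ)) h) f : Sem D (.arr σ τ')) =
      fun v => cast (congrArg (Sem D) h) (f v) := by
  subst h
  rfl

/-- Negation is involutive at all kinds. -/
theorem Sem.bot_bot : ∀ (τ : Kd) (v : Sem D τ),
    Sem.bot τ.dual (Sem.bot τ v) = cast (congrArg (Sem D) τ.dual_dual.symm) v
  | .nat, _ => rfl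
  | .o .pos, _ => rfl
  | .o .neg, Y => Sem.bot_pos_bot_neg Y
  | .arr _ τ, f => (funext fun v => Sem.bot_bot τ (f v) :
      (fun v => Sem.bot τ.dual (Sem.bot τ (f v))) = _).trans
        (Sem.cast_arr τ.dual_dual.symm f).symm

theorem TyCon.interp_cast {Q : Kd → Type} (J : ∀ τ : Kd, Q τ → Sem D τ) {τ τ' : Kd}
    (h : τ = τ') (T : TyCon Q τ) (ρ : Valn D) :
    (cast (congrArg (TyCon Q) h) T).interp J ρ = cast (congrArg (Sem D) h) (T.interp J ρ) := by
  subst h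
  rfl

theorem Sem.bot_ex {I : Type} [Nonempty I] : ∀ {a : Pol} (F : I → Sem D (.o a)),
    Sem.bot (.o a) (Sem.ex F) = Sem.all (a := a.dual) fun v => Sem.bot (.o a) (F v)
  | .pos, _ => rfl
  | .neg, _ => rfl

theorem Sem.bot_all {I : Type} [Nonempty I] : ∀ {a : Pol} (F : I → Sem D (.o a)),
    Sem.bot (.o a) (Sem.all F) = Sem.ex (a := a.dual) fun v => Sem.bot (.o a) (F v)
  | .pos, _ => rfl
  | .neg, _ => rfl

theorem Sem.bot_absent : ∀ a : Pol, Sem.bot (.o a) (Sem.absent D a) = Sem.absent D a.dual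
  | .pos => rfl
  | .neg => rfl

/-- At each concrete polarity the double dual computes, so splitting on polarities avoids casts. -/
theorem Sem.tensor_bot_bot : ∀ {a b : Pol} (X : Sem D (.o a)) (Y : Sem D (.o b)),
    Sem.tensor (a := a.dual.dual) (b := b.dual.dual) (Sem.bot (.o a.dual) (Sem.bot (.o a) X))
      (Sem.bot (.o b.dual) (Sem.bot (.o b) Y)) = Sem.tensor X Y
  | .pos, .pos, _, _ => rfl
  | .pos, .neg, _, Y => by simp only [Sem.bot_pos_bot_neg]; rfl
  | .neg, .pos, X, _ => by simp only [Sem.bot_pos_bot_neg]; rfl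
  | .neg, .neg, X, Y => by simp only [Sem.bot_pos_bot_neg]

theorem Sem.down_bot_bot : ∀ {a : Pol} (X : Sem D (.o a)),
    Sem.down (a := a.dual.dual) (Sem.bot (.o a.dual) (Sem.bot (.o a) X)) = Sem.down X
  | .pos, _ => rfl
  | .neg, X => by simp only [Sem.bot_pos_bot_neg]

/-- The interpretation of the negation of a constructor is the orthogonal of its
interpretation. -/
theorem TyCon.interp_neg {Q : Kd → Type} (J : ∀ τ : Kd, Q τ → Sem D τ) {τ : Kd}
    (T : TyCon Q τ) (ρ : Valn D) : T.neg.interp J ρ = Sem.bot τ (T.interp J ρ) := by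
  induction T generalizing ρ with
  | var x τ => rfl
  | dvar x τ =>
    exact (TyCon.interp_cast J τ.dual_dual.symm (.var x τ) ρ).trans (Sem.bot_bot τ _).symm
  | lam x σ T ih => exact funext fun v => ih _
  | app T U ih _ => exact congrFun (ih ρ) _
  | zero => rfl
  | succ => rfl
  | recur τ => rfl
  | drecur τ =>
    exact (TyCon.interp_cast J τ.recKd.dual_dual.symm (.recur τ) ρ).trans
      (Sem.bot_bot τ.recKd _).symm
  | const k => rfl
  | @dconst τ k =>
    exact (TyCon.interp_cast J τ.dual_dual.symm (.const k) ρ).trans (Sem.bot_bot τ _).symm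
  | tensor A B ihA ihB =>
    simp only [TyCon.neg, TyCon.interp, ihA, ihB, Sem.tensor_bot_bot]
    rfl
  | par A B ihA ihB =>
    simp only [TyCon.neg, TyCon.interp, ihA, ihB]
    rfl
  | ex x σ A ih =>
    simp only [TyCon.neg, TyCon.interp, ih, Sem.bot_ex]
  | all x σ A ih =>
    simp only [TyCon.neg, TyCon.interp, ih, Sem.bot_all]
  | down A ih =>
    simp only [TyCon.neg, TyCon.interp, ih, Sem.down_bot_bot]
    rfl
  | up A ih =>
    simp only [TyCon.neg, TyCon.interp, ih]
    rfl
  | eqImp T U A _ _ ih =>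
    simp only [TyCon.neg, TyCon.interp, ih]
    split_ifs
    · rfl
    · exact (Sem.bot_absent _).symm

theorem MAL.interp_neg_toCon (J : ∀ τ : Kd, NoConst τ → Sem D τ) {a : Pol} (A : MAL a)
    (ρ : Valn D) : A.neg.toCon.interp J ρ = Sem.bot (.o a) (A.toCon.interp J ρ) := by
  rw [← TyCon.interp_neg]
  -- What remains is syntactic: the embedding of formulas into constructors commutes with negation.
  congr 1
  induction A with
  | var X => rfl
  | dvar X => rfl
  | tensor A B ihA ihB => simp only [MAL.neg, MAL.toCon, TyCon.neg, ihA, ihB]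
  | par A B ihA ihB => simp only [MAL.neg, MAL.toCon, TyCon.neg, ihA, ihB]
  | down A ih => simp only [MAL.neg, MAL.toCon, TyCon.neg, ih]
  | up A ih => simp only [MAL.neg, MAL.toCon, TyCon.neg, ih]

theorem Valn.update_same (ρ : Valn D) (x : ℕ) (σ : Kd) (v : Sem D σ) :
    ρ.update x σ v σ x = v := by
  simp [Valn.update]

theorem Valn.update_of_ne (ρ : Valn D) {x y : ℕ} (σ τ : Kd) (v : Sem D σ) (h : x ≠ y) :
    ρ.update x σ v τ y = ρ τ y := by
  simp [Valn.update, h]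

theorem Valn.update_of_kind_ne (ρ : Valn D) (x y : ℕ) {σ τ : Kd} (v : Sem D σ) (h : σ ≠ τ) :
    ρ.update x σ v τ y = ρ τ y := by
  simp [Valn.update, h]

theorem TyCon.interp_numeral {Q : Kd → Type} (J : ∀ τ : Kd, Q τ → Sem D τ) (ρ : Valn D)
    (n : ℕ) : (TyCon.numeral n : TyCon Q .nat).interp J ρ = n := by
  induction n with
  | zero => rfl
  | succ n ih => exact congrArg Nat.succ ih

theorem condAdd_interp (J : ∀ τ : Kd, CondConst τ → Sem D τ) (ρ : Valn D) (p q : ℕ) :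
    (condAdd.interp J ρ : ℕ → ℕ → ℕ) p q = p + q := by
  induction q with
  | zero => rfl
  | succ q ih => exact congrArg Nat.succ ih

/-- Negative elements are orthogonals of sets of positive values, so realizing a negative formula is
plain membership. -/
theorem Sem.biorth_neg (Y : Sem D (.o .neg)) : Y.biorth = Y.toSet := by
  obtain ⟨S, X, hX, rfl⟩ := Y
  exact Duality.orthPos_orthNeg_orthPos (D.values X hX)

end NegationInterpretation

/-! ### Semantics of the connectives of the forcing translation -/

section ForcingInterpretation

variable {Kp Km : Type} {D : PropDomain (normDuality Kp Km)}
  (hD : ∀ p : ℕ, condSet Kp Km p ∈ D.carrier)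

/-- The hypothesis `hz` expresses semantically that the bound variables `0` and `1` are not free in
`Z`, which avoids any syntactic treatment of free variables. -/
theorem forcOrth_interp {a : Pol} (Z : TyCon CondConst (.arr .nat (.o a))) (ρ : Valn D)
    (z : ℕ → Set (Tm Kp Km × Unit))
    (hz : ∀ r p q : ℕ, Sem.toSet (a := a) (Z.interp (CondConst.interp D hD)
      ((ρ.update 0 .nat r).update 1 .nat p) q) = z q) (r : ℕ) :
    Sem.toSet (a := .neg) ((forcOrth Z).interp (CondConst.interp D hD) ρ r) =
      forcOrthSet z r := by
  -- A negative `∀` is by definition the orthogonal of the union of the remembered positive sets, so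
  -- these are compared before taking orthogonals.
  refine congrArg (normDuality Kp Km).orthPos (Set.iUnion_congr fun r' => ?_)
  set ρ' := (ρ.update 0 .nat r).update 1 .nat r'
  have h1 : ρ' .nat 1 = r' := Valn.update_same _ _ _ _
  have h0 : ρ' .nat 0 = r := (Valn.update_of_ne _ _ _ _ (by decide)).trans
    (Valn.update_same _ _ _ _)
  have hC : (condAt (.app (.app condAdd (.var 0 .nat)) (.var 1 .nat))).interp
      (CondConst.interp D hD) ρ' = (⟨condSet Kp Km (r + r'), hD _⟩ : Sem D (.o .pos)) := by
    have := condAdd_interp (CondConst.interp D hD) ρ' (ρ' .nat 0) (ρ' .nat 1)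
    rw [h0, h1] at this
    refine congrArg (fun p : ℕ => (⟨condSet Kp Km p, hD p⟩ : Sem D (.o .pos))) ?_
    rw [← this, ← h0, ← h1]
    rfl
  -- `A ⊸ B^⊥` unfolds to `A^⊥ ⅋ B^⊥`, which remembers the tensor of the double orthogonals of `A`
  -- and `B`.
  have hT : ∀ (A : TyCon CondConst (.o a)) (B : TyCon CondConst (.o .pos)),
      Sem.bot (.o .neg) ((TyCon.limp (b := .neg) A B.neg).interp (CondConst.interp D hD) ρ') =
        Sem.tensor (A.interp (CondConst.interp D hD) ρ') (B.interp (CondConst.interp D hD) ρ') := by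
    intro A B
    rw [← Sem.tensor_bot_bot (A.interp (CondConst.interp D hD) ρ'), ← TyCon.interp_neg _ A,
      ← TyCon.interp_neg _ B]
    rfl
  refine (congrArg (Sem.toSet (a := .pos)) (hT _ _)).trans ?_
  rw [hC]
  refine congrArg (fun X => tensorSet X (condSet Kp Km (r + r'))) ?_
  refine Eq.trans ?_ (hz r r' r')
  exact congrArg (fun p : ℕ => Sem.toSet (a := a) (Z.interp (CondConst.interp D hD) ρ' p)) h1

theorem forcTensor_interp {a b : Pol} (Y : TyCon CondConst (.arr .nat (.o a)))
    (Z : TyCon CondConst (.arr .nat (.o b))) (J : ∀ τ : Kd, CondConst τ → Sem D τ)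
    (ρ : Valn D) (y z : ℕ → Set (Tm Kp Km × Unit))
    (hy : ∀ r p q s : ℕ, Sem.toSet (a := a)
      (Y.interp J (((ρ.update 0 .nat r).update 1 .nat p).update 2 .nat q) s) = y s)
    (hz : ∀ r p q s : ℕ, Sem.toSet (a := b)
      (Z.interp J (((ρ.update 0 .nat r).update 1 .nat p).update 2 .nat q) s) = z s)
    (r : ℕ) :
    Sem.toSet (a := .pos) ((forcTensor Y Z).interp J ρ r) =
      ⋃ (p : ℕ) (q : ℕ) (_ : r = p + q), tensorSet (y p) (z q) := by
  refine Set.iUnion_congr fun p => Set.iUnion_congr fun q => ?_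
  set ρ' := ((ρ.update 0 .nat r).update 1 .nat p).update 2 .nat q
  have h2 : ρ' .nat 2 = q := Valn.update_same _ _ _ _
  have h1 : ρ' .nat 1 = p := (Valn.update_of_ne _ _ _ _ (by decide)).trans
    (Valn.update_same _ _ _ _)
  have h0 : ρ' .nat 0 = r := ((Valn.update_of_ne _ _ _ _ (by decide)).trans
    (Valn.update_of_ne _ _ _ _ (by decide))).trans (Valn.update_same _ _ _ _)
  have hadd : (TyCon.app (.app condAdd (.var 1 .nat)) (.var 2 .nat)).interp J ρ' =
      (p + q : ℕ) := by
    have := condAdd_interp J ρ' (ρ' .nat 1) (ρ' .nat 2)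
    refine Eq.trans this ?_
    rw [h1, h2]
  have hvar : (TyCon.var 0 .nat : TyCon CondConst .nat).interp J ρ' = r := h0
  have hT : ((TyCon.tensor (.app Y (.var 1 .nat)) (.app Z (.var 2 .nat))).interp J ρ').toSet =
      tensorSet (y p) (z q) := by
    refine congrArg₂ tensorSet ((congrArg (fun s : ℕ => Sem.toSet (a := a) (Y.interp J ρ' s))
      h1).trans (hy _ _ _ _)) ((congrArg (fun s : ℕ => Sem.toSet (a := b) (Z.interp J ρ' s))
      h2).trans (hz _ _ _ _))
  change Sem.toSet (a := .pos) ((TyCon.eqImp _ _ _).interp J ρ') = _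
  rw [TyCon.interp, hadd, hvar]
  -- When the equation fails, the implication is `∅`, which matches the union over an empty index.
  by_cases h : r = p + q
  · rw [if_pos h, hT]
    simp [h]
  · rw [if_neg h]
    simp only [h, Set.iUnion_of_empty]
    rfl

theorem forcDown_interp {a : Pol} (Z : TyCon CondConst (.arr .nat (.o a)))
    (J : ∀ τ : Kd, CondConst τ → Sem D τ) (ρ : Valn D) (z : ℕ → Set (Tm Kp Km × Unit))
    (hz : ∀ r p : ℕ, Sem.toSet (a := a) (Z.interp J (ρ.update 0 .nat r) p) = z p) (r : ℕ) :
    Sem.toSet (a := .pos) ((forcDown Z).interp J ρ r) = downSet (z r) := by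
  refine congrArg downSet (Eq.trans ?_ (hz r r))
  exact congrArg (fun s : ℕ => Sem.toSet (a := a) (Z.interp J (ρ.update 0 .nat r) s))
    (Valn.update_same ρ 0 .nat r)

end ForcingInterpretation

/-! ## Comparison of the two models -/

/-- The terms of a set of weighted terms which have the weight `p`. -/
def weightSlice {Kp Km : Type} (X : Set (Tm Kp Km × ℕ)) (p : ℕ) : Set (Tm Kp Km × Unit) :=
  {w | (w.1, p) ∈ X}

/-- The equation `r = p₁ + p₂` in the translation of `⊗` records how the weight of a pair splits
between its components. -/
theorem weightSlice_tensorSet {Kp Km : Type} (X Y : Set (Tm Kp Km × ℕ)) (r : ℕ) :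
    weightSlice (tensorSet X Y) r =
      ⋃ (p : ℕ) (q : ℕ) (_ : r = p + q), tensorSet (weightSlice X p) (weightSlice Y q) := by
  ext ⟨t, _⟩
  simp only [Set.mem_iUnion]
  constructor
  · rintro ⟨a, b, V, W, p, q, hV, hW, h⟩
    obtain ⟨rfl, rfl⟩ := Prod.mk.inj h
    exact ⟨p, q, rfl, a, b, V, W, (), (), hV, hW, rfl⟩
  · rintro ⟨p, q, rfl, a, b, V, W, _, _, hV, hW, h⟩
    obtain ⟨rfl, -⟩ := Prod.mk.inj h
    exact ⟨a, b, V, W, p, q, hV, hW, rfl⟩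

theorem weightSlice_downSet {Kp Km : Type} (X : Set (Tm Kp Km × ℕ)) (r : ℕ) :
    weightSlice (downSet X) r = downSet (weightSlice X r) := by
  ext ⟨t, _⟩
  constructor
  · rintro ⟨a, V, p, hV, h⟩
    obtain ⟨rfl, rfl⟩ := Prod.mk.inj h
    exact ⟨a, V, (), hV, rfl⟩
  · rintro ⟨a, V, _, hV, h⟩
    obtain ⟨rfl, -⟩ := Prod.mk.inj h
    exact ⟨a, V, r, hV, rfl⟩

theorem weightSlice_orthPos {Kp Km : Type} {X : Set (Tm Kp Km × ℕ)}
    (hX : X ⊆ posValues Kp Km ℕ) (hne : X.Nonempty) (r : ℕ) :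
    weightSlice ((timeDuality Kp Km).orthPos X) r = forcOrthSet (weightSlice X) r := by
  ext ⟨t, _⟩
  exact mem_timeDuality_orthPos_iff (fun _ _ => Iff.rfl) hX hne t r

theorem weightSlice_orthNeg {Kp Km : Type} {Y : Set (Tm Kp Km × ℕ)}
    (hY : Y ⊆ (timeDuality Kp Km).negSide) (hne : Y.Nonempty) (r : ℕ) :
    weightSlice ((timeDuality Kp Km).orthNeg Y) r = forcOrthSet (weightSlice Y) r := by
  ext ⟨t, _⟩
  exact mem_timeDuality_orthNeg_iff (fun _ _ => Iff.rfl) hY hne t r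

/-! ### Inhabitation of formulas in the time model -/

section TimeModel

variable {Kp Km : Type} {D : PropDomain (timeDuality Kp Km)}

/-- A cut of a positive value against `✠₋` is already normal, so it costs no β-step. All negative
sets are thereby inhabited. -/
theorem daiN_mem_orthPos {X : Set (Tm Kp Km × ℕ)} (hX : X ⊆ posValues Kp Km ℕ) (p : ℕ) :
    (Tm.neg .daiN, p) ∈ (timeDuality Kp Km).orthPos X := by
  refine ⟨⟨_, rfl⟩, fun x hx => ?_⟩
  obtain ⟨V, hV⟩ := hX hx
  exact ⟨_, _, hV, rfl, cut_daiN_mem_timePole V _⟩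

theorem daiN_mem_negElem (Y : Sem D (.o .neg)) (p : ℕ) : (Tm.neg .daiN, p) ∈ Y.toSet := by
  obtain ⟨S, X, hX, rfl⟩ := Y
  exact daiN_mem_orthPos (D.values X hX) p

/-- Every formula has a value among its elements. -/
theorem MAL.exists_val_mem_interp {ρ : Valn D}
    (hρ : ∀ X : ℕ, (ρ (.o .pos) X).toSet = {w | ∃ p : ℕ, w = (Tm.dai, p)})
    {a : Pol} (A : MAL a) : ∃ (V : Syn Kp Km [] a.valCat) (p : ℕ),
      (Tm.val V, p) ∈ (A.toCon.interp (NoConst.interp D) ρ).toSet := by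
  induction A with
  | var X => exact ⟨.daiP, 0, (hρ X).symm.subset ⟨0, rfl⟩⟩
  | dvar X => exact ⟨.daiN, 0, daiN_mem_negElem _ 0⟩
  | tensor A B ihA ihB =>
    obtain ⟨V, p, hV⟩ := ihA
    obtain ⟨W, q, hW⟩ := ihB
    exact ⟨.pair V W, p + q, _, _, V, W, p, q, hV, hW, rfl⟩
  | par A B => exact ⟨.daiN, 0, daiN_mem_negElem _ 0⟩
  | down A ih =>
    obtain ⟨V, p, hV⟩ := ih
    exact ⟨.box V, p, _, V, p, hV, rfl⟩
  | up A => exact ⟨.daiN, 0, daiN_mem_negElem _ 0⟩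

theorem MAL.interp_nonempty {ρ : Valn D}
    (hρ : ∀ X : ℕ, (ρ (.o .pos) X).toSet = {w | ∃ p : ℕ, w = (Tm.dai, p)})
    {a : Pol} (A : MAL a) : (A.toCon.interp (NoConst.interp D) ρ).toSet.Nonempty :=
  let ⟨_, _, h⟩ := A.exists_val_mem_interp hρ
  ⟨_, h⟩

/-- The terms of weight `p` of the orthogonal of a positive formula. -/
theorem MAL.weightSlice_orth {ρ : Valn D}
    (hρ : ∀ X : ℕ, (ρ (.o .pos) X).toSet = {w | ∃ p : ℕ, w = (Tm.dai, p)})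
    (P : MAL .pos) (r : ℕ) :
    weightSlice (Sem.orth (P.toCon.interp (NoConst.interp D) ρ)).toSet r =
      forcOrthSet (weightSlice (P.toCon.interp (NoConst.interp D) ρ).toSet) r :=
  weightSlice_orthPos (D.values _ (Subtype.prop _)) (P.interp_nonempty hρ) r

end TimeModel

/-! ### The translation computes slices by weight -/

section Comparison

variable {Kp Km : Type} {D : PropDomain (timeDuality Kp Km)} {ρ : Valn D}
  {D' : PropDomain (normDuality Kp Km)}

/-- The valuations which send every variable of kind `ι → o⁺` to the constant family `{dai₊}`. -/
def Valn.DaiConst (ρ' : Valn D') : Prop :=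
  ∀ X p : ℕ, Sem.toSet (a := .pos) (ρ' (.arr .nat (.o .pos)) X p) = {(Tm.dai, ())}

/-- The binders of the translation are all of kind `ι`, so they cannot capture the predicate
variables, even those with the same name. -/
theorem Valn.DaiConst.update {ρ' : Valn D'} (h : ρ'.DaiConst) (x n : ℕ) :
    Valn.DaiConst (ρ'.update x .nat n) := fun X p => by
  rw [Valn.update_of_kind_ne ρ' x X (σ := .nat) (τ := .arr .nat (.o .pos)) n (by decide)]
  exact h X p

theorem Valn.DaiConst.apply_eq_weightSlice {ρ' : Valn D'} (h : ρ'.DaiConst)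
    (hρ : ∀ X : ℕ, (ρ (.o .pos) X).toSet = {w | ∃ p : ℕ, w = (Tm.dai, p)}) (X p : ℕ) :
    Sem.toSet (a := .pos) (ρ' (.arr .nat (.o .pos)) X p) =
      weightSlice (ρ (.o .pos) X).toSet p := by
  rw [h X p, hρ X]
  ext ⟨t, _⟩
  simp [weightSlice]

/-- At the condition `p`, the translation of a formula has the elements of weight `p` of the
formula. -/
theorem MAL.star_interp
    (hρ : ∀ X : ℕ, (ρ (.o .pos) X).toSet = {w | ∃ p : ℕ, w = (Tm.dai, p)})
    (hD' : ∀ p : ℕ, condSet Kp Km p ∈ D'.carrier) : ∀ {a : Pol} (A : MAL a) {ρ' : Valn D'},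
    ρ'.DaiConst → ∀ p : ℕ,
    Sem.toSet (a := a) (A.star.interp (CondConst.interp D' hD') ρ' p) =
      weightSlice (A.toCon.interp (NoConst.interp D) ρ).toSet p
  | _, .var X, ρ', h, p => by
    rw [MAL.star]
    exact h.apply_eq_weightSlice hρ X p
  | _, .dvar X, ρ', h, p => by
    rw [MAL.star]
    exact (forcOrth_interp hD' (.var X _) ρ' _ (fun r p q =>
      ((h.update 0 r).update 1 p).apply_eq_weightSlice hρ X q) p).trans
      ((MAL.var X).weightSlice_orth hρ p).symm
  | _, .tensor A B, ρ', h, p => by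
    rw [MAL.star]
    exact (forcTensor_interp _ _ _ _ _ _
      (fun r p q => MAL.star_interp hρ hD' A (((h.update 0 r).update 1 p).update 2 q))
      (fun r p q => MAL.star_interp hρ hD' B (((h.update 0 r).update 1 p).update 2 q)) p).trans
      (weightSlice_tensorSet _ _ p).symm
  | _, .par A B, ρ', h, p => by
    rw [MAL.star]
    -- Five binders are crossed: two of the forcing orthogonal, three of the forcing tensor.
    refine (forcOrth_interp hD' _ _ _ (fun r p q =>
      (forcTensor_interp _ _ _ _ _ _
        (fun r' p' q' => MAL.star_interp hρ hD' A.neg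
          (((((h.update 0 r).update 1 p).update 0 r').update 1 p').update 2 q'))
        (fun r' p' q' => MAL.star_interp hρ hD' B.neg
          (((((h.update 0 r).update 1 p).update 0 r').update 1 p').update 2 q')) q).trans
        (weightSlice_tensorSet _ _ q).symm) p).trans
      (((MAL.tensor A.neg B.neg).weightSlice_orth hρ p).symm.trans ?_)
    -- The translation negates the subformulas syntactically, the interpretation of `⅋`
    -- semantically; both agree.
    simp only [MAL.toCon, TyCon.interp, MAL.interp_neg_toCon]
  | _, .down A, ρ', h, p => by
    rw [MAL.star]
    exact (forcDown_interp _ _ _ _ (fun r => MAL.star_interp hρ hD' A (h.update 0 r)) p).trans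
      (weightSlice_downSet _ p).symm
  | _, .up A, ρ', h, p => by
    rw [MAL.star]
    refine (forcOrth_interp hD' _ _ _ (fun r p q =>
      (forcDown_interp _ _ _ _
        (fun r' => MAL.star_interp hρ hD' A.neg (((h.update 0 r).update 1 p).update 0 r'))
        q).trans (weightSlice_downSet _ q).symm) p).trans
      (((MAL.down A.neg).weightSlice_orth hρ p).symm.trans ?_)
    simp only [MAL.toCon, TyCon.interp, MAL.interp_neg_toCon]
-- The cases of `⅋` and `↑` recurse on negations of subformulas, which are not subterms but have the
-- same size as the subformulas.
termination_by _ A => A.size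
decreasing_by all_goals simp only [MAL.size, MAL.size_neg]; omega

end Comparison

/-! ### The theorem -/

theorem mainTheorem5 {Kp Km : Type}
    (D : PropDomain (timeDuality Kp Km)) (ρ : Valn D)
    (hρ : ∀ X : ℕ, (ρ (.o .pos) X).toSet = {w | ∃ p : ℕ, w = (Tm.dai, p)})
    (D' : PropDomain (normDuality Kp Km))
    (hD' : ∀ p : ℕ, condSet Kp Km p ∈ D'.carrier) (ρ' : Valn D')
    (hρ' : ∀ X p : ℕ, Sem.toSet (a := .pos) (ρ' (.arr .nat (.o .pos)) X p) = {(Tm.dai, ())})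
    {a : Pol} (A : MAL a) (t : Tm Kp Km) (n : ℕ) :
    Realizes (NoConst.interp D) ρ (t, n) A.toCon ↔
      Realizes (CondConst.interp D' hD') ρ' (t, ()) (forces (TyCon.numeral n) A) := by
  unfold Realizes
  -- The forcing formula is negative whatever the polarity of `A`, so its biorthogonal disappears.
  rw [Sem.biorth_neg]
  have happ : ∀ T : TyCon CondConst (.arr .nat (.o .neg)),
      Sem.toSet (a := .neg) ((T.app (TyCon.numeral n)).interp (CondConst.interp D' hD') ρ') =
        Sem.toSet (a := .neg) (T.interp (CondConst.interp D' hD') ρ' n) := fun T =>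
    congrArg (fun p : ℕ => Sem.toSet (a := .neg) (T.interp (CondConst.interp D' hD') ρ' p))
      (TyCon.interp_numeral _ ρ' n)
  cases a with
  | neg =>
    rw [Sem.biorth_neg, forces, happ, A.star_interp hρ hD' hρ']
    rfl
  | pos =>
    set X := A.toCon.interp (NoConst.interp D) ρ
    have hX : X.toSet ⊆ posValues Kp Km ℕ := D.values _ X.2
    have horth : ∀ r q p : ℕ, Sem.toSet (a := .neg) ((forcOrth A.star).interp
        (CondConst.interp D' hD') ((ρ'.update 0 .nat r).update 1 .nat q) p) =
          weightSlice ((timeDuality Kp Km).orthPos X.toSet) p := fun r q p =>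
      (forcOrth_interp hD' _ _ _ (fun r' q' => A.star_interp hρ hD'
        ((((Valn.DaiConst.update hρ' 0 r).update 1 q).update 0 r').update 1 q')) p).trans
        (weightSlice_orthPos hX (A.interp_nonempty hρ) p).symm
    -- The orthogonal of `X` contains `✠₋`, so the outer forcing orthogonal is the slice of the
    -- biorthogonal of `X`.
    rw [forces, happ, forcOrth_interp hD' _ _ _ horth,
      ← weightSlice_orthNeg (fun y hy => hy.1) ⟨_, daiN_mem_orthPos hX 0⟩]
    rfl
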